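/- Let $(X,d)$ be a complete separable metric space and let $E : X \to \mathbb{R}\cup\{+\infty\}$ be lower semicontinuous, with dense domain $D(E)=\{x\in X : E(x)<+\infty\}$, and bounded from below on every $d$-bounded subset of $X$. Let $\lambda\in\mathbb{R}$ and suppose that for every $x\in X$ there exists an $\mathrm{EVI}_\lambda$-gradient flow of $E$ starting from $x$, that is, a curve $(\gamma_t)_{t>0}$ in $X$, absolutely continuous on every compact subinterval of $(0,\infty)$, with $\gamma_t\to x\in\overline{D(E)}$ as $t\downarrow 0$ and such that, for every $y\in X$, $$\frac12\frac{d}{dt}d^2(\gamma_t,y)+\frac{\lambda}{2}d^2(\gamma_t,y)+E(\gamma_t)\le E(y)\qquad\text{for a.e. } t>0 .$$ Then $E$ is $\lambda$-convex along every geodesic: for every curve $\gamma:[0,1]\to X$ with $d(\gamma_t,\gamma_s)=|t-s|\,d(\gamma_0,\gamma_1)$ for all $s,t\in[0,1]$, $$E(\gamma_\theta)\le(1-\theta)E(\gamma_0)+\theta E(\gamma_1)-\frac{\lambda}{2}\theta(1-\theta)\,d^2(\gamma_0,\gamma_1)\qquad\text{for all }\theta\in[0,1],$$ with the convention $0\cdot(+\infty)=0$.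 -/

import Mathlib

open Set Filter Topology MeasureTheory

/-- The domain `D(E)`: the points where `E` is not `+∞`. -/
def energyDomain {X : Type*} (E : X → EReal) : Set X :=
  {x | E x ≠ ⊤}

/-- Standing assumptions on the functional `E : X → ℝ ∪ {+∞}`: lower semicontinuous, with dense
domain, and bounded below on bounded sets. -/
structure IsAdmissibleEnergy {X : Type*} [MetricSpace X] (E : X → EReal) : Prop where
  ne_bot : ∀ x, E x ≠ ⊥
  lowerSemicontinuous : LowerSemicontinuous E
  dense_domain : Dense (energyDomain E)
  bounded_below : ∀ B : Set X, Bornology.IsBounded B → ∃ c : ℝ, ∀ x ∈ B, (c : EReal) ≤ E x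

/-- `γ ∈ AC_loc((0,∞), X)`: absolutely continuous on every compact subinterval of `(0,∞)`.
Only the values of `γ` at positive times matter. -/
def LocallyACOnPos {X : Type*} [MetricSpace X] (γ : ℝ → X) : Prop :=
  ∀ a b : ℝ, 0 < a → a ≤ b → AbsolutelyContinuousOnInterval γ a b

/-- `(γ_t)_{t > 0}` is a gradient flow of `E` in the sense of the Evolution Variational Inequality
with parameter `lam`. The exceptional null set of times may depend on `y`. For a locally absolutely
continuous curve, `s ↦ d²(γ_s, y)` is differentiable at almost every `t > 0`, so `deriv` is the
actual derivative there. -/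
structure IsEVIFlow {X : Type*} [MetricSpace X] (E : X → EReal) (lam : ℝ) (γ : ℝ → X) :
    Prop where
  locallyAC : LocallyACOnPos γ
  evi : ∀ y : X, ∀ᵐ t : ℝ, 0 < t →
    ((1 / 2 * deriv (fun s => dist (γ s) y ^ 2) t + lam / 2 * dist (γ t) y ^ 2 : ℝ) : EReal)
      + E (γ t) ≤ E y

/-- The `EVI` gradient flow `γ` starts at `x`. -/
structure IsEVIFlowFrom {X : Type*} [MetricSpace X] (E : X → EReal) (lam : ℝ) (γ : ℝ → X)
    (x : X) : Prop where
  isEVIFlow : IsEVIFlow E lam γ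
  mem_closure : x ∈ closure (energyDomain E)
  tendsto : Tendsto γ (𝓝[>] 0) (𝓝 x)

/-- `γ` restricted to `[0,1]` is a (constant-speed, minimizing) geodesic. -/
def IsMetricGeodesic {X : Type*} [MetricSpace X] (γ : ℝ → X) : Prop :=
  ∀ s ∈ Icc (0 : ℝ) 1, ∀ t ∈ Icc (0 : ℝ) 1, dist (γ t) (γ s) = |t - s| * dist (γ 0) (γ 1)

/-- `E` is `lam`-convex along the curve `γ : [0,1] → X`, with the convention `0 * ∞ = 0`. -/
def IsLambdaConvexAlong {X : Type*} [MetricSpace X] (E : X → EReal) (lam : ℝ) (γ : ℝ → X) :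
    Prop :=
  ∀ θ ∈ Icc (0 : ℝ) 1,
    E (γ θ) ≤ ((1 - θ : ℝ) : EReal) * E (γ 0) + (θ : EReal) * E (γ 1)
      - ((lam / 2 * θ * (1 - θ) * dist (γ 0) (γ 1) ^ 2 : ℝ) : EReal)

/-! Run the flow `η` from an intermediate point `x` of the geodesic and average the EVIs tested at
its endpoints with weights `1 - θ`, `θ`. If convexity failed at `x`, lower semicontinuity would keep
the energy too high for short times, so the averaged squared distance would drop strictly below its
initial value. But on a geodesic that value is already the minimum allowed by
`mul_dist_sq_le_combination`. -/

/-- The distance from a fixed point to an absolutely continuous curve is absolutely continuous. -/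
theorem AbsolutelyContinuousOnInterval.dist_const {X : Type*} [MetricSpace X] {γ : ℝ → X}
    {a b : ℝ} (h : AbsolutelyContinuousOnInterval γ a b) (y : X) :
    AbsolutelyContinuousOnInterval (fun s => dist (γ s) y) a b :=
  squeeze_zero (fun _ => Finset.sum_nonneg fun _ _ => dist_nonneg)
    (fun _ => Finset.sum_le_sum fun _ _ => abs_dist_sub_le _ _ _) h

/-- An absolutely continuous function whose derivative is a.e. at most `c` grows at most at
rate `c`. -/
theorem AbsolutelyContinuousOnInterval.sub_le_of_ae_deriv_le {f : ℝ → ℝ} {a b c : ℝ}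
    (hab : a ≤ b) (hf : AbsolutelyContinuousOnInterval f a b)
    (hc : ∀ᵐ t : ℝ, t ∈ Icc a b → deriv f t ≤ c) : f b - f a ≤ c * (b - a) := by
  rw [← hf.integral_deriv_eq_sub]
  calc ∫ t in a..b, deriv f t ≤ ∫ _ in a..b, c :=
        intervalIntegral.integral_mono_ae_restrict hab hf.intervalIntegrable_deriv
          intervalIntegrable_const ((ae_restrict_iff' measurableSet_Icc).2 hc)
    _ = c * (b - a) := by rw [intervalIntegral.integral_const, smul_eq_mul, mul_comm]

/-- Weighted two-point inequality: a convex combination of the squared distances from `z` to `x`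
and `y` is at least `θ (1 - θ) d(x, y)²`. -/
theorem mul_dist_sq_le_combination {X : Type*} [MetricSpace X] (x y z : X) {θ : ℝ}
    (h0 : 0 ≤ θ) (h1 : θ ≤ 1) :
    θ * (1 - θ) * dist x y ^ 2 ≤ (1 - θ) * dist z x ^ 2 + θ * dist z y ^ 2 := by
  have htri : dist x y ≤ dist z x + dist z y := dist_triangle_left x y z
  have hsq : dist x y ^ 2 ≤ (dist z x + dist z y) ^ 2 := pow_le_pow_left₀ dist_nonneg htri 2
  have hw : 0 ≤ θ * (1 - θ) := mul_nonneg h0 (sub_nonneg.2 h1)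
  calc θ * (1 - θ) * dist x y ^ 2 ≤ θ * (1 - θ) * (dist z x + dist z y) ^ 2 :=
        mul_le_mul_of_nonneg_left hsq hw
    _ ≤ (1 - θ) * dist z x ^ 2 + θ * dist z y ^ 2 := by
        linarith [sq_nonneg ((1 - θ) * dist z x - θ * dist z y)]

theorem LocallyACOnPos.dist_sq {X : Type*} [MetricSpace X] {γ : ℝ → X} (h : LocallyACOnPos γ)
    (y : X) {a b : ℝ} (ha : 0 < a) (hab : a ≤ b) :
    AbsolutelyContinuousOnInterval (fun s => dist (γ s) y ^ 2) a b := by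
  have hd := (h a b ha hab).dist_const y
  have hfun : (fun s => dist (γ s) y ^ 2) = (fun s => dist (γ s) y) * fun s => dist (γ s) y := by
    ext s
    simp [sq]
  rw [hfun]
  exact hd.mul hd

/-- The evolution variational inequality with a real lower bound in place of the energy. -/
theorem IsEVIFlow.ae_deriv_le {X : Type*} [MetricSpace X] {E : X → EReal} {lam : ℝ} {γ : ℝ → X}
    (h : IsEVIFlow E lam γ) {y : X} {e m : ℝ} (he : E y = e) :
    ∀ᵐ t : ℝ, 0 < t → (m : EReal) ≤ E (γ t) →
      1 / 2 * deriv (fun s => dist (γ s) y ^ 2) t + lam / 2 * dist (γ t) y ^ 2 + m ≤ e := by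
  filter_upwards [h.evi y] with t ht ht0 hm
  have key := (add_le_add_right hm _).trans (ht ht0)
  rw [he] at key
  exact_mod_cast key

/-- Convexity inequality at an intermediate point of a geodesic whose endpoints have finite
energy. -/
theorem energy_le_of_isEVIFlowFrom {X : Type*} [MetricSpace X] {E : X → EReal} {lam : ℝ}
    (hE : LowerSemicontinuous E) {x x₀ x₁ : X} {η : ℝ → X} (hη : IsEVIFlowFrom E lam η x)
    {θ : ℝ} (h0 : 0 ≤ θ) (h1 : θ ≤ 1) (hd0 : dist x x₀ = θ * dist x₀ x₁)
    (hd1 : dist x x₁ = (1 - θ) * dist x₀ x₁) {e₀ e₁ : ℝ} (he0 : E x₀ = e₀) (he1 : E x₁ = e₁) :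
    E x ≤ (((1 - θ) * e₀ + θ * e₁ - lam / 2 * θ * (1 - θ) * dist x₀ x₁ ^ 2 : ℝ) : EReal) := by
  set K : ℝ := (1 - θ) * e₀ + θ * e₁ - lam / 2 * θ * (1 - θ) * dist x₀ x₁ ^ 2 with hK
  by_contra! hlt
  obtain ⟨m, hKm, hmE⟩ := EReal.lt_iff_exists_real_btwn.1 hlt
  have hKm' : K < m := EReal.coe_lt_coe_iff.1 hKm
  -- Defect in the two-point inequality: nonnegative everywhere, zero in the limit at `x`.
  let G : ℝ → ℝ := fun s =>
    (1 - θ) * dist (η s) x₀ ^ 2 + θ * dist (η s) x₁ ^ 2 - θ * (1 - θ) * dist x₀ x₁ ^ 2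
  have hGlim : Tendsto G (𝓝[>] 0) (𝓝 0) := by
    have hx := hη.tendsto
    have hlim : Tendsto G (𝓝[>] 0) (𝓝 ((1 - θ) * dist x x₀ ^ 2 + θ * dist x x₁ ^ 2
        - θ * (1 - θ) * dist x₀ x₁ ^ 2)) :=
      ((((hx.dist tendsto_const_nhds).pow 2).const_mul _).add
        (((hx.dist tendsto_const_nhds).pow 2).const_mul _)).sub_const _
    convert hlim using 2
    rw [hd0, hd1]
    ring
  -- The averaged EVI gives `G' / 2 ≤ -(m - K) - lam / 2 * G`. Spending half the gap on the `lam`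
  -- term, of either sign, leaves `G' ≤ -(m - K)`.
  have hev : ∀ᶠ s in 𝓝[>] (0 : ℝ), (m : EReal) ≤ E (η s) ∧ -(m - K) / 2 < lam / 2 * G s := by
    have hE' := hη.tendsto.eventually (hE x m hmE)
    have hG' := (hGlim.const_mul (lam / 2)).eventually
      (lt_mem_nhds (show -(m - K) / 2 < lam / 2 * 0 by linarith))
    exact (hE'.mono fun _ => le_of_lt).and hG'
  obtain ⟨δ, hδ, hsub⟩ := mem_nhdsGT_iff_exists_Ioc_subset.1 hev
  have hδ0 : 0 < δ := hδ
  -- Absolute continuity is only available away from time `0`, hence the start at `s > 0`, with `s ↓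
  -- 0` afterwards.
  have hdecr : ∀ s ∈ Ioc 0 δ, G δ - G s ≤ -(m - K) * (δ - s) := by
    intro s hs
    have hac0 := hη.isEVIFlow.locallyAC.dist_sq x₀ hs.1 hs.2
    have hac1 := hη.isEVIFlow.locallyAC.dist_sq x₁ hs.1 hs.2
    have hacC : AbsolutelyContinuousOnInterval
        (fun _ : ℝ => θ * (1 - θ) * dist x₀ x₁ ^ 2) s δ :=
      (LipschitzWith.const _).lipschitzOnWith.absolutelyContinuousOnInterval (K := 0)
    have hacG : AbsolutelyContinuousOnInterval G s δ :=
      ((hac0.const_mul (1 - θ)).add (hac1.const_mul θ)).sub hacC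
    refine hacG.sub_le_of_ae_deriv_le hs.2 ?_
    filter_upwards [hac0.ae_differentiableAt, hac1.ae_differentiableAt,
      hη.isEVIFlow.ae_deriv_le (m := m) he0, hη.isEVIFlow.ae_deriv_le (m := m) he1]
      with t hD0 hD1 hV0 hV1 ht
    have ht0 : 0 < t := hs.1.trans_le ht.1
    obtain ⟨hmt, hGt⟩ := hsub ⟨ht0, ht.2⟩
    have htu : t ∈ uIcc s δ := by rwa [uIcc_of_le hs.2]
    have hderiv := ((((hD0 htu).hasDerivAt.const_mul (1 - θ)).add
      ((hD1 htu).hasDerivAt.const_mul θ)).sub_const (θ * (1 - θ) * dist x₀ x₁ ^ 2)).deriv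
    have hderiv' : deriv G t = (1 - θ) * deriv (fun s => dist (η s) x₀ ^ 2) t
        + θ * deriv (fun s => dist (η s) x₁ ^ 2) t := hderiv
    rw [hderiv']
    have i0 := mul_le_mul_of_nonneg_left (hV0 ht0 hmt) (sub_nonneg.2 h1)
    have i1 := mul_le_mul_of_nonneg_left (hV1 ht0 hmt) h0
    simp only [G] at hGt
    linarith
  have hδG : G δ ≤ -(m - K) * δ := by
    have hl : Tendsto (fun s => G δ - G s) (𝓝[>] 0) (𝓝 (G δ - 0)) := hGlim.const_sub _
    have hr : Tendsto (fun s => -(m - K) * (δ - s)) (𝓝[>] 0) (𝓝 (-(m - K) * (δ - 0))) :=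
      ((tendsto_id.mono_left nhdsWithin_le_nhds).const_sub _).const_mul _
    have := le_of_tendsto_of_tendsto hl hr
      (mem_of_superset (Ioc_mem_nhdsGT hδ0) hdecr)
    simpa using this
  have hGnonneg : 0 ≤ G δ := sub_nonneg.2 (mul_dist_sq_le_combination x₀ x₁ (η δ) h0 h1)
  linarith [mul_pos (sub_pos.2 hKm') hδ0]

theorem theorem4p6 {X : Type*} [MetricSpace X] [CompleteSpace X]
    [TopologicalSpace.SeparableSpace X] (E : X → EReal) (hE : IsAdmissibleEnergy E) (lam : ℝ)
    (hflow : ∀ x : X, ∃ γ : ℝ → X, IsEVIFlowFrom E lam γ x) :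
    ∀ γ : ℝ → X, IsMetricGeodesic γ → IsLambdaConvexAlong E lam γ := by
  intro γ hγ θ hθ
  -- Once both weights are positive, an infinite endpoint energy makes the right side `⊤`.
  rcases eq_or_lt_of_le hθ.1 with rfl | h0
  · simp
  rcases eq_or_lt_of_le hθ.2 with rfl | h1
  · simp
  have h1' : 0 < 1 - θ := sub_pos.2 h1
  have hbot : ∀ {c : ℝ} (x : X), 0 < c → (c : EReal) * E x ≠ ⊥ := by
    intro c x hc
    have hx := hE.ne_bot x
    induction h : E x with
    | bot => exact absurd h hx
    | coe e => exact_mod_cast EReal.coe_ne_bot (c * e)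
    | top => simp [EReal.coe_mul_top_of_pos hc]
  by_cases ht0 : E (γ 0) = ⊤
  · rw [ht0, EReal.coe_mul_top_of_pos h1', EReal.top_add_of_ne_bot (hbot _ h0),
      EReal.top_sub_coe]
    exact le_top
  by_cases ht1 : E (γ 1) = ⊤
  · rw [ht1, EReal.coe_mul_top_of_pos h0, EReal.add_top_of_ne_bot (hbot _ h1'),
      EReal.top_sub_coe]
    exact le_top
  have he0 := (EReal.coe_toReal ht0 (hE.ne_bot _)).symm
  have he1 := (EReal.coe_toReal ht1 (hE.ne_bot _)).symm
  obtain ⟨η, hη⟩ := hflow (γ θ)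
  have hd0 : dist (γ θ) (γ 0) = θ * dist (γ 0) (γ 1) := by
    rw [hγ 0 (by simp) θ hθ, sub_zero, abs_of_pos h0]
  have hd1 : dist (γ θ) (γ 1) = (1 - θ) * dist (γ 0) (γ 1) := by
    rw [hγ 1 (by simp) θ hθ, abs_sub_comm, abs_of_pos h1']
  have key := energy_le_of_isEVIFlowFrom hE.lowerSemicontinuous hη hθ.1 hθ.2 hd0 hd1 he0 he1
  rw [he0, he1]
  exact_mod_cast key
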